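/- **Theorem.** Let $\mathsf B$ be a locally presentable abelian category. Then $\mathsf B$ has enough projective objects if and only if it has a projective generator (a projective object $P$ such that $\mathrm{Hom}_{\mathsf B}(P,-)$ is faithful). Assume that this is the case. Let $\mathsf C(\mathsf B)$ be the abelian category of unbounded cochain complexes in $\mathsf B$, let $\mathsf C(\mathsf B)_{\mathrm{ac}}$ be the class of acyclic complexes, and let $\mathsf C(\mathsf B_{\mathrm{proj}})_{\mathrm{hpr}}$ be the class of homotopy projective complexes of projective objects, i.e., of the complexes $Q$ such that every term $Q^i$ is projective in $\mathsf B$ and every morphism of complexes from $Q$ to an acyclic complex is null-homotopic. (1) The pair $(\mathsf C(\mathsf B_{\mathrm{proj}})_{\mathrm{hpr}},\ \mathsf C(\mathsf B)_{\mathrm{ac}})$ is a hereditary complete cotorsion pair in $\mathsf C(\mathsf B)$, and for every projective generator $P$ of $\mathsf B$ it is generated by the set $\{P[i]\}_{i\in\mathbb Z}$, where $P$ is viewed as a complex concentrated in degree $0$. Here a pair of classes of objects $(\mathsf L,\mathsf R)$ in an abelian category $\mathsf E$ is a *cotorsion pair* if $\mathsf R=\mathsf L^{\perp_1}=\{X:\mathrm{Ext}^1(L,X)=0\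 \forall L\in\mathsf L\}$ and $\mathsf L={}^{\perp_1}\mathsf R=\{Y:\mathrm{Ext}^1(Y,R)=0\ \forall R\in\mathsf R\}$; it is *generated* by $\mathsf S$ if $\mathsf R=\mathsf S^{\perp_1}$ and $\mathsf L={}^{\perp_1}\mathsf R$; it is *complete* if for every object $E$ there are short exact sequences $0\to R'\to L\to E\to 0$ and $0\to E\to R\to L'\to 0$ with $R,R'\in\mathsf R$ and $L,L'\in\mathsf L$; a complete cotorsion pair is *hereditary* if $\mathrm{Ext}^n(L,R)=0$ for all $L\in\mathsf L$, $R\in\mathsf R$, $n\ge 1$. (2) The triple $(\mathsf L,\mathsf W,\mathsf R)=(\mathsf C(\mathsf B_{\mathrm{proj}})_{\mathrm{hpr}},\ \mathsf C(\mathsf B)_{\mathrm{ac}},\ \mathsf C(\mathsf B))$ is a cofibrantly generated hereditary abelian model structure on $\mathsf C(\mathsf B)$. That is, there is a model structure on $\mathsf C(\mathsf B)$ such that: $\mathsf L$, $\mathsf W$, $\mathsf R$ are the classes of cofibrant, weakly trivial and fibrant objects, respectively (so all objects are fibrant); the cofibrations are the monomorphisms with cofibrant cokernel and the fibrations are the epimorphisms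 with fibrant kernel (*abelian*); the class of cofibrant objects is closed under kernels of epimorphisms between its objects and the class of fibrant objects is closed under cokernels of monomorphisms between its objects (*hereditary*); and there are sets of morphisms $\mathcal I$ and $\mathcal J$ such that the trivial fibrations are the morphisms with the right lifting property with respect to $\mathcal I$ and the fibrations are the morphisms with the right lifting property with respect to $\mathcal J$ (*cofibrantly generated*). -/

import Mathlib

open CategoryTheory Limits HomotopicalAlgebra

universe w v u

namespace AbelianModel

section Abelian

variable {C : Type u} [Category.{v} C] [Abelian C]

/-- `Ext^n(X, Y) = 0`. The `Ext`-groups are Mathlib's, taken in the universe in which they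
exist without any assumption on `C`. -/
def ExtVanishes (X Y : C) (n : ℕ) : Prop :=
  letI := HasExt.standard C
  ∀ e : Abelian.Ext.{max u v} X Y n, e = 0

/-- The class of all `X` such that `Ext^1(L, X) = 0` for all `L` in the class `L`. -/
def rightPerp (L : ObjectProperty C) : ObjectProperty C :=
  fun X => ∀ A : C, L A → ExtVanishes A X 1

/-- The class of all `Y` such that `Ext^1(Y, R) = 0` for all `R` in the class `R`. -/
def leftPerp (R : ObjectProperty C) : ObjectProperty C :=
  fun Y => ∀ A : C, R A → ExtVanishes Y A 1

/-- `(L, R)` is a cotorsion pair. -/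
structure IsCotorsionPair (L R : ObjectProperty C) : Prop where
  right_eq : R = rightPerp L
  left_eq : L = leftPerp R

/-- `(L, R)` is the cotorsion pair generated by the class of objects `S`. -/
structure IsGeneratedBy (S L R : ObjectProperty C) : Prop where
  right_eq : R = rightPerp S
  left_eq : L = leftPerp R

/-- Every object `E` has a special precover sequence `0 ⟶ A ⟶ B ⟶ E ⟶ 0` with `A` in `R` and
`B` in `L`, and a special preenvelope sequence `0 ⟶ E ⟶ A ⟶ B ⟶ 0` with `A` in `R` and
`B` in `L`. -/
structure IsComplete (L R : ObjectProperty C) : Prop where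
  precover : ∀ E : C, ∃ (A B : C) (i : A ⟶ B) (p : B ⟶ E) (h : i ≫ p = 0),
    R A ∧ L B ∧ (ShortComplex.mk i p h).ShortExact
  preenvelope : ∀ E : C, ∃ (A B : C) (i : E ⟶ A) (p : A ⟶ B) (h : i ≫ p = 0),
    R A ∧ L B ∧ (ShortComplex.mk i p h).ShortExact

/-- `Ext^n` vanishes for all `n ≥ 1` between objects of `L` and objects of `R`. -/
def IsHereditary (L R : ObjectProperty C) : Prop :=
  ∀ A B : C, L A → R B → ∀ n : ℕ, 1 ≤ n → ExtVanishes A B n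

/-- The class of monomorphisms with cokernel in `L`. -/
def monoWithCokernel (L : ObjectProperty C) : MorphismProperty C :=
  fun _ _ f => Mono f ∧ L (cokernel f)

/-- The class of epimorphisms with kernel in `R`. -/
def epiWithKernel (R : ObjectProperty C) : MorphismProperty C :=
  fun _ _ f => Epi f ∧ R (kernel f)

end Abelian

section Model

variable (C : Type u) [Category.{v} C] [Abelian C] [ModelCategory C]

/-- The class of cofibrant objects. -/
def cofibrantObj : ObjectProperty C := fun X => IsCofibrant X

/-- The class of fibrant objects. -/
def fibrantObj : ObjectProperty C := fun X => IsFibrant X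

/-- The class of weakly trivial objects: those `X` for which `0 ⟶ X` is a weak equivalence
(the zero object being the initial object). -/
def weaklyTrivialObj : ObjectProperty C := fun X => WeakEquivalence (initial.to X)

/-- A model structure on an abelian category is abelian if the cofibrations are the
monomorphisms with cofibrant cokernel and the fibrations are the epimorphisms with fibrant
kernel. -/
structure IsAbelianModelStructure : Prop where
  cofibrations_eq : cofibrations C = monoWithCokernel (cofibrantObj C)
  fibrations_eq : fibrations C = epiWithKernel (fibrantObj C)

/-- The model structure is hereditary: the cofibrant objects are closed under kernels of
epimorphisms and the fibrant objects are closed under cokernels of monomorphisms.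
(For an abelian model structure, each of the two conditions implies the other.) -/
structure IsHereditaryModelStructure : Prop where
  kernel_mem : ∀ S : ShortComplex C, S.ShortExact →
    cofibrantObj C S.X₂ → cofibrantObj C S.X₃ → cofibrantObj C S.X₁
  cokernel_mem : ∀ S : ShortComplex C, S.ShortExact →
    fibrantObj C S.X₁ → fibrantObj C S.X₂ → fibrantObj C S.X₃

/-- The model structure is cofibrantly generated (relative to the universe `w` of small sets):
both weak factorization systems `(cofibrations, trivial fibrations)` and
`(trivial cofibrations, fibrations)` are generated by (small) sets of morphisms. -/
structure IsCofibrantlyGenerated : Prop where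
  trivialFibrations_eq : ∃ I : MorphismProperty C,
    MorphismProperty.IsSmall.{w} I ∧ trivialFibrations C = I.rlp
  fibrations_eq : ∃ J : MorphismProperty C,
    MorphismProperty.IsSmall.{w} J ∧ fibrations C = J.rlp

end Model

section Complexes

variable (B : Type u) [Category.{v} B] [Abelian B]

/-- The class of homotopy projective complexes of projective objects. -/
def hprProj : ObjectProperty (CochainComplex B ℤ) :=
  fun K => (∀ i : ℤ, Projective (K.X i)) ∧ K.IsKProjective

/-- The class of acyclic complexes. -/
def acyclic : ObjectProperty (CochainComplex B ℤ) :=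
  fun K => K.Acyclic

variable {B} in
/-- The class of all shifts `P[i]`, for an integer `i`, of the object `P` viewed as a complex
concentrated in degree zero. -/
def shifts (P : B) : ObjectProperty (CochainComplex B ℤ) :=
  ObjectProperty.ofObj fun i : ℤ => ((CochainComplex.singleFunctor B 0).obj P)⟦i⟧

end Complexes

end AbelianModel

/-!
Fix a projective generator `P` of `B`, and write `L ⟶ idCone L ⟶ L⟦1⟧` for the degreewise split
exact sequence of the cone of `𝟙 L`. Everything rests on three properties of these cones: a
morphism out of `L` extends to `idCone L` exactly when it is null-homotopic
(`exists_idCone_extension_iff`), `idCone L` is contractible, and it is a projective object of the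
category of complexes as soon as the terms of `L` are projective (`projective_idCone`). Hence, for
`L` with projective terms, `Ext^1(L⟦1⟧, R) = 0` if and only if all morphisms `L ⟶ R` are
null-homotopic, and the groups `Ext^n(L, R)` with `n > 1` are computed by replacing `L` with
`L⟦-1⟧`. This shows that homotopy projective complexes of projectives are `Ext`-orthogonal to
acyclic complexes. Conversely, the left orthogonal of the acyclic complexes is described
by a lifting property along epimorphisms with acyclic kernel (`LiftsAlongAcyclic`); testing it on
the epimorphisms `idCone (R⟦-1⟧) ⟶ R` gives homotopy projectivity, and testing it on
the epimorphisms between cones of identities gives the projectivity of the terms.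

Since `P` is a projective generator, `Hom(P, -)` is faithful and exact, so `K` is acyclic as soon
as all morphisms `P[i] ⟶ K` are null-homotopic (`acyclic_of_homotopy_single`). Therefore the
`P[i]` generate the cotorsion pair. In the same way, the morphisms with the right lifting property
with respect to the inclusions of the `P[i]` in their cones are the epimorphisms with acyclic
kernel (`rlp_genCof`), and the morphisms with the right lifting property with respect to
the morphisms from zero to these cones are the epimorphisms (`rlp_genTrivCof`). The objects `P[i]`
are presentable, because the cone of the identity of `P[i]` corepresents `X ↦ Hom(P, X^m)` for a
suitable `m`, and `P[i]` is a cokernel of a morphism between two such cones. The small object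
argument then factors any morphism as a monomorphism with cokernel in the left class followed by
an epimorphism with acyclic kernel. Factorizations of `0 ⟶ E` and `E ⟶ 0` give the completeness of
the cotorsion pair, and the factorization of general morphisms is one of the two required for the
model structure. For the other one, a morphism `X ⟶ Y` is factored through `X ⊞ D`, where `D` is
a projective complex with an epimorphism to `Y`. Both lifting axioms follow from the fact that
`Ext^1` of the cokernel with values in the kernel contains the obstruction to lifting
(`hasLiftingProperty_of_extVanishes`).
-/

namespace AbelianModel

/-! ### Vanishing of `Ext` and lifting problems -/

section Abelian

open Abelian

variable {C : Type u} [Category.{v} C] [Abelian C]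

/-- The obstruction to lifting `f` is the pullback of the class of `S` along `f`. -/
lemma ExtVanishes.exists_lift {Q : C} {S : ShortComplex C} (hS : S.ShortExact)
    (h : ExtVanishes Q S.X₁ 1) (f : Q ⟶ S.X₃) : ∃ g : Q ⟶ S.X₂, g ≫ S.g = f := by
  let _ := HasExt.standard C
  obtain ⟨x, hx⟩ := Ext.covariant_sequence_exact₃ Q hS (Ext.mk₀ f) (zero_add 1) (h _)
  obtain ⟨g, rfl⟩ := Ext.addEquiv₀.symm.surjective x
  exact ⟨g, (Ext.mk₀_bijective _ _).injective (by simpa using hx)⟩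

/-- The obstruction to extending `f` is the pushforward of the class of `S` along `f`. -/
lemma ExtVanishes.exists_extension {R : C} {S : ShortComplex C} (hS : S.ShortExact)
    (h : ExtVanishes S.X₃ R 1) (f : S.X₁ ⟶ R) : ∃ g : S.X₂ ⟶ R, S.f ≫ g = f := by
  let _ := HasExt.standard C
  obtain ⟨x, hx⟩ := Ext.contravariant_sequence_exact₁ hS R (Ext.mk₀ f) (add_zero 1) (h _)
  obtain ⟨g, rfl⟩ := Ext.addEquiv₀.symm.surjective x
  exact ⟨g, (Ext.mk₀_bijective _ _).injective (by simpa using hx)⟩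

/-- As `S.X₂` is projective, every class in `Ext^1(S.X₃, R)` is the pushforward of the class of
`S` along a morphism `S.X₁ ⟶ R`, and it vanishes if this morphism extends to `S.X₂`. -/
lemma extVanishes_one_of_exists_extension {R : C} {S : ShortComplex C} (hS : S.ShortExact)
    [Projective S.X₂] (h : ∀ f : S.X₁ ⟶ R, ∃ g : S.X₂ ⟶ R, S.f ≫ g = f) :
    ExtVanishes S.X₃ R 1 := by
  let _ := HasExt.standard C
  intro e
  obtain ⟨x, rfl⟩ := Ext.contravariant_sequence_exact₃ hS R e
    (Ext.eq_zero_of_projective _) (add_zero 1)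
  obtain ⟨f, rfl⟩ := Ext.addEquiv₀.symm.surjective x
  obtain ⟨g, rfl⟩ := h f
  change hS.extClass.comp (Ext.mk₀ (S.f ≫ g)) _ = 0
  rw [← Ext.mk₀_comp_mk₀, hS.extClass_comp_assoc]

/-- Dimension shifting. -/
lemma extVanishes_succ {R : C} {S : ShortComplex C} (hS : S.ShortExact)
    [Projective S.X₂] (n : ℕ) (h : ExtVanishes S.X₁ R n) : ExtVanishes S.X₃ R (n + 1) := by
  let _ := HasExt.standard C
  intro e
  obtain ⟨x, rfl⟩ := Ext.contravariant_sequence_exact₃ hS R e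
    (Ext.eq_zero_of_projective _) (add_comm 1 n)
  rw [h x, Ext.comp_zero]

lemma extVanishes_of_projective (P R : C) [Projective P] (n : ℕ) : ExtVanishes P R (n + 1) := by
  let _ := HasExt.standard C
  intro e
  exact Ext.eq_zero_of_projective _

lemma extVanishes_X₁ {R : C} {S : ShortComplex C} (hS : S.ShortExact) {n : ℕ}
    (h₂ : ExtVanishes S.X₂ R n) (h₃ : ExtVanishes S.X₃ R (n + 1)) : ExtVanishes S.X₁ R n := by
  let _ := HasExt.standard C
  intro e
  obtain ⟨x, rfl⟩ := Ext.contravariant_sequence_exact₁ hS R e (add_comm 1 n) (h₃ _)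
  rw [h₂ x, Ext.comp_zero]

lemma shortExact_of_mono {X Y : C} (i : X ⟶ Y) [Mono i] :
    (ShortComplex.mk i (cokernel.π i) (cokernel.condition i)).ShortExact where
  exact := ShortComplex.exact_cokernel i

lemma shortExact_of_epi {X Y : C} (p : X ⟶ Y) [Epi p] :
    (ShortComplex.mk (kernel.ι p) p (kernel.condition p)).ShortExact where
  exact := ShortComplex.exact_kernel p

/-- A monomorphism with cokernel `Q` has the left lifting property with respect to an
epimorphism with kernel `K` as soon as `Ext^1(Q, K) = 0`: the obstruction to lifting the bottom
map lies in `Ext^1(Q, K)`, and such a lift can be corrected to be compatible with the top map. -/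
lemma hasLiftingProperty_of_extVanishes {A B X Y : C} (i : A ⟶ B) (p : X ⟶ Y) [Mono i] [Epi p]
    (h : ExtVanishes (cokernel i) (kernel p) 1) : HasLiftingProperty i p where
  sq_hasLift {a b} sq := by
    let _ := HasExt.standard C
    have hi := shortExact_of_mono i
    have hp := shortExact_of_epi p
    obtain ⟨l, hl⟩ : ∃ l : B ⟶ X, l ≫ p = b := by
      -- The obstruction vanishes on `A`, where `a` is a lift, so it comes from `Ext^1` of the
      -- cokernel of `i`.
      have h₀ : (Ext.mk₀ b).comp hp.extClass (zero_add 1) = 0 := by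
        obtain ⟨o, ho⟩ := Ext.contravariant_sequence_exact₂ hi _
          ((Ext.mk₀ b).comp hp.extClass (zero_add 1)) (by
            dsimp
            rw [Ext.mk₀_comp_mk₀_assoc, ← sq.w, ← Ext.mk₀_comp_mk₀_assoc]
            erw [hp.comp_extClass]
            simp)
        rw [← ho, h o, Ext.comp_zero]
      obtain ⟨x, hx⟩ := Ext.covariant_sequence_exact₃ B hp (Ext.mk₀ b) (zero_add 1) h₀
      obtain ⟨g, rfl⟩ := Ext.addEquiv₀.symm.surjective x
      exact ⟨g, (Ext.mk₀_bijective _ _).injective (by simpa using hx)⟩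
    -- The difference between `a` and `i ≫ l` takes values in the kernel of `p`, and extends to `B`.
    obtain ⟨t, ht⟩ := ExtVanishes.exists_extension hi h
      (kernel.lift p (a - i ≫ l) (by simp [hl, sq.w]))
    dsimp at ht
    exact ⟨⟨{
      l := l + t ≫ kernel.ι p
      fac_left := by simp [reassoc_of% ht]
      fac_right := by simp [hl] }⟩⟩

end Abelian

/-! ### Cones of identities -/

section Cones

open CochainComplex CochainComplex.HomComplex HomologicalComplex

variable {B : Type u} [Category.{v} B] [Abelian B]

/-- The mapping cone of the identity of `L`. -/
noncomputable abbrev idCone (L : CochainComplex B ℤ) : CochainComplex B ℤ := mappingCone (𝟙 L)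

/-- The morphism from the cone of `𝟙 L` given by a cochain `α` of degree `-1`. Compatibility with
the differentials forces its restriction to `L` to be the coboundary of `α`. -/
noncomputable def idConeDesc {L X : CochainComplex B ℤ} (α : Cochain L X (-1)) :
    idCone L ⟶ X :=
  mappingCone.desc (𝟙 L) α (Cocycle.homOf (Cocycle.mk (δ (-1) 0 α) 1 (by simp) (by simp [δ_δ])))
    (by simp)

lemma inl_idConeDesc {L X : CochainComplex B ℤ} (α : Cochain L X (-1)) :
    (mappingCone.inl (𝟙 L)).comp (Cochain.ofHom (idConeDesc α)) (add_zero _) = α :=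
  mappingCone.inl_desc _ _ _ _

lemma idCone_hom_ext {L X : CochainComplex B ℤ} {f g : idCone L ⟶ X}
    (h : (mappingCone.inl (𝟙 L)).comp (Cochain.ofHom f) (add_zero _) =
      (mappingCone.inl (𝟙 L)).comp (Cochain.ofHom g) (add_zero _)) : f = g := by
  apply Cochain.ofHom_injective
  rw [mappingCone.ext_cochain_from_iff (𝟙 L) (-1) 0 (by simp)]
  refine ⟨h, ?_⟩
  have := congr_arg (δ (-1) 0) h
  simpa [δ_comp_zero_cochain _ _ _ (neg_add_cancel 1)] using this

/-- Morphisms that factor through the cone of an identity are null-homotopic, as this cone is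
contractible. -/
lemma homotopy_zero_of_idCone {K X Y : CochainComplex B ℤ} (g : X ⟶ idCone K) (p : idCone K ⟶ Y) :
    Nonempty (Homotopy (g ≫ p) 0) :=
  ⟨(Homotopy.ofEq (by simp)).trans ((((mappingCone.homotopyToZeroOfId K).compLeft g).compRight
    p).trans (Homotopy.ofEq (by simp)))⟩

/-- An extension of `f` to the cone of `𝟙 L` is the same as a null-homotopy of `f`. -/
lemma exists_idCone_extension_iff {L X : CochainComplex B ℤ} (f : L ⟶ X) :
    (∃ g : idCone L ⟶ X, mappingCone.inr (𝟙 L) ≫ g = f) ↔ Nonempty (Homotopy f 0) := by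
  constructor
  · rintro ⟨g, rfl⟩
    exact homotopy_zero_of_idCone _ g
  · rintro ⟨h⟩
    obtain ⟨z, hz⟩ := Cochain.equivHomotopy _ _ h
    exact ⟨mappingCone.desc (𝟙 L) z f (by simpa using hz.symm), by simp⟩

/-- Morphisms from `idCone L` are arbitrary cochains of degree `-1` on `L`, with no compatibility
with the differentials, so they can be lifted term by term. -/
lemma projective_idCone (L : CochainComplex B ℤ) [∀ i, Projective (L.X i)] :
    Projective (idCone L) where
  factors {X Y} f e _ := by
    let α : Cochain L X (-1) := Cochain.mk fun p q hpq =>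
      Projective.factorThru
        (((mappingCone.inl (𝟙 L)).comp (Cochain.ofHom f) (add_zero _)).v p q hpq) (e.f q)
    refine ⟨idConeDesc α, idCone_hom_ext ?_⟩
    ext p q hpq
    have := congr_arg (fun β => β.v p q hpq) (inl_idConeDesc α)
    simp only [Cochain.comp_zero_cochain_v, Cochain.ofHom_v] at this
    simp only [Cochain.comp_zero_cochain_v, Cochain.ofHom_v, comp_f, reassoc_of% this]
    simp [α]

/-- The morphism to the cone of `𝟙 X` given by a cochain `β` of degree zero. Its other component
is forced to be the opposite of the coboundary of `β`. -/
noncomputable def idConeLift {Q X : CochainComplex B ℤ} (β : Cochain Q X 0) : Q ⟶ idCone X :=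
  mappingCone.lift (𝟙 X) (Cocycle.mk (-(δ 0 1 β)) 2 (by simp) (by simp [δ_δ])) β (by simp)

lemma idConeLift_snd {Q X : CochainComplex B ℤ} (β : Cochain Q X 0) :
    (Cochain.ofHom (idConeLift β)).comp (mappingCone.snd (𝟙 X)) (zero_add 0) = β :=
  mappingCone.lift_snd _ _ _ _

lemma acyclic_of_homotopy_id {K : CochainComplex B ℤ} (h : Homotopy (𝟙 K) 0) : K.Acyclic := by
  intro i
  rw [exactAt_iff_isZero_homology, IsZero.iff_id_eq_zero, ← homologyMap_id, h.homologyMap_eq,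
    homologyMap_zero]

lemma acyclic_idCone (L : CochainComplex B ℤ) : (idCone L).Acyclic :=
  acyclic_of_homotopy_id (mappingCone.homotopyToZeroOfId L)

lemma quasiIso_of_acyclic {X Y : CochainComplex B ℤ} (f : X ⟶ Y) (hX : X.Acyclic)
    (hY : Y.Acyclic) : QuasiIso f where
  quasiIsoAt i := by
    rw [quasiIsoAt_iff_exactAt f i (hX i)]
    exact hY i

lemma acyclic_X₁ {S : ShortComplex (CochainComplex B ℤ)} (hS : S.ShortExact)
    (h₂ : S.X₂.Acyclic) (h₃ : S.X₃.Acyclic) : S.X₁.Acyclic :=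
  hS.acyclic_X₁ (quasiIso_of_acyclic _ h₂ h₃)

/-- If `e : L⟦1⟧ ≅ M`, the short complex `L ⟶ idCone L ⟶ M`. -/
noncomputable abbrev idConeShortComplex {L M : CochainComplex B ℤ} (e : L⟦(1 : ℤ)⟧ ≅ M) :
    ShortComplex (CochainComplex B ℤ) :=
  ShortComplex.mk (mappingCone.inr (𝟙 L))
    ((mappingCone.triangleRotateShortComplex (𝟙 L)).g ≫ e.hom)
    ((Category.assoc _ _ _).symm.trans
      (((mappingCone.triangleRotateShortComplex (𝟙 L)).zero =≫ e.hom).trans zero_comp))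

lemma idConeShortComplex_shortExact {L M : CochainComplex B ℤ} (e : L⟦(1 : ℤ)⟧ ≅ M) :
    (idConeShortComplex e).ShortExact := by
  have h : (mappingCone.triangleRotateShortComplex (𝟙 L)).ShortExact :=
    shortExact_of_degreewise_shortExact _
      fun i => (mappingCone.triangleRotateShortComplexSplitting (𝟙 L) i).shortExact
  exact ShortComplex.shortExact_of_iso
    (ShortComplex.isoMk (S₁ := mappingCone.triangleRotateShortComplex (𝟙 L))
      (Iso.refl _) (Iso.refl _) e
      ((Category.id_comp _).trans (Category.comp_id _).symm) (Category.id_comp _)) h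

/-- The canonical isomorphism `L⟦-1⟧⟦1⟧ ≅ L`. -/
noncomputable def shiftNegOneIso (L : CochainComplex B ℤ) : (L⟦(-1 : ℤ)⟧)⟦(1 : ℤ)⟧ ≅ L :=
  (shiftEquiv (CochainComplex B ℤ) (1 : ℤ)).counitIso.app L

/-- Any complex `L` is a quotient of the contractible complex `idCone (L⟦-1⟧)`. -/
noncomputable abbrev idConeCover (L : CochainComplex B ℤ) : idCone (L⟦(-1 : ℤ)⟧) ⟶ L :=
  (idConeShortComplex (shiftNegOneIso L)).g

instance (L : CochainComplex B ℤ) : Epi (idConeCover L) :=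
  (idConeShortComplex_shortExact _).epi_g

end Cones

/-! ### Homotopy projective complexes of projective objects -/

section Hpr

open CochainComplex CochainComplex.HomComplex HomologicalComplex

variable {B : Type u} [Category.{v} B] [Abelian B]

/-- Any morphism from `Q` lifts along any epimorphism with acyclic kernel. This holds for objects
of the left orthogonal of the acyclic complexes, and it is strong enough to characterize them
(`hprProj_eq_leftPerp`). -/
def LiftsAlongAcyclic (Q : CochainComplex B ℤ) : Prop :=
  ∀ ⦃X Y : CochainComplex B ℤ⦄ (p : X ⟶ Y) [Epi p], (kernel p).Acyclic →
    ∀ f : Q ⟶ Y, ∃ g : Q ⟶ X, g ≫ p = f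

lemma LiftsAlongAcyclic.of_iso {Q Q' : CochainComplex B ℤ} (h : LiftsAlongAcyclic Q)
    (e : Q ≅ Q') : LiftsAlongAcyclic Q' := by
  intro X Y p _ hp f
  obtain ⟨g, hg⟩ := h p hp (e.hom ≫ f)
  exact ⟨e.inv ≫ g, by simp [hg]⟩

lemma liftsAlongAcyclic_of_leftPerp {Q : CochainComplex B ℤ}
    (h : leftPerp (acyclic B) Q) : LiftsAlongAcyclic Q := by
  intro X Y p _ hp f
  exact (h _ hp).exists_lift (shortExact_of_epi p) f

lemma liftsAlongAcyclic_of_projective (Q : CochainComplex B ℤ) [Projective Q] :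
    LiftsAlongAcyclic Q := by
  intro X Y p _ hp f
  exact ⟨Projective.factorThru f p, by simp⟩

lemma acyclic_shift_neg_one {K : CochainComplex B ℤ} (hK : K.Acyclic) :
    (K⟦(-1 : ℤ)⟧).Acyclic :=
  acyclic_X₁ (idConeShortComplex_shortExact (shiftNegOneIso K)) (acyclic_idCone _) hK

/-- `LiftsAlongAcyclic` for an epimorphism whose kernel is given by a short exact sequence. -/
lemma LiftsAlongAcyclic.exists_lift {Q : CochainComplex B ℤ} (h : LiftsAlongAcyclic Q)
    {S : ShortComplex (CochainComplex B ℤ)} (hS : S.ShortExact) (h₁ : S.X₁.Acyclic)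
    (f : Q ⟶ S.X₃) : ∃ g : Q ⟶ S.X₂, g ≫ S.g = f := by
  have := hS.epi_g
  have e : S.X₁ ≅ kernel S.g := hS.fIsKernel.conePointUniqueUpToIso (limit.isLimit _)
  exact h S.g (fun i => (h₁ i).of_iso e) f

/-- A morphism from `Q` to an acyclic complex `R` lifts to the contractible complex
`idCone (R⟦-1⟧)`. -/
lemma LiftsAlongAcyclic.isKProjective {Q : CochainComplex B ℤ} (h : LiftsAlongAcyclic Q) :
    Q.IsKProjective where
  nonempty_homotopy_zero {R} f hR := by
    obtain ⟨g, rfl⟩ := h.exists_lift (idConeShortComplex_shortExact (shiftNegOneIso R))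
      (acyclic_shift_neg_one hR) f
    exact homotopy_zero_of_idCone g _

/-- The morphism between cones of identities induced by a morphism of complexes. -/
noncomputable def idConeMap {X Y : CochainComplex B ℤ} (p : X ⟶ Y) : idCone X ⟶ idCone Y :=
  mappingCone.map (𝟙 X) (𝟙 Y) p p (by simp)

instance {X Y : CochainComplex B ℤ} (p : X ⟶ Y) [Epi p] : Epi (idConeMap p) where
  left_cancellation g h hgh := idCone_hom_ext (by
    ext i j hij
    have := congr_arg (fun f => (mappingCone.inl (𝟙 X)).v i j hij ≫ f.f j) hgh
    simpa [idConeMap, mappingCone.map, cancel_epi] using this)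

/-- Cochains of degree zero from `Q` to `Y` are the same as morphisms from `Q` to the cone of
`𝟙 Y`, so that they can be lifted along epimorphisms. -/
lemma LiftsAlongAcyclic.exists_cochain_lift {Q : CochainComplex B ℤ} (h : LiftsAlongAcyclic Q)
    {X Y : CochainComplex B ℤ} (p : X ⟶ Y) [Epi p] (β : Cochain Q Y 0) :
    ∃ γ : Cochain Q X 0, γ.comp (Cochain.ofHom p) (add_zero 0) = β := by
  obtain ⟨g, hg⟩ := h (idConeMap p)
    (acyclic_X₁ (shortExact_of_epi (idConeMap p)) (acyclic_idCone _) (acyclic_idCone _))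
    (idConeLift β)
  refine ⟨(Cochain.ofHom g).comp (mappingCone.snd (𝟙 X)) (zero_add 0), ?_⟩
  rw [← idConeLift_snd β, ← hg]
  ext i
  have : (mappingCone.snd (𝟙 X)).v i i (add_zero i) ≫ p.f i =
      (idConeMap p).f i ≫ (mappingCone.snd (𝟙 Y)).v i i (add_zero i) := by
    rw [mappingCone.ext_from_iff _ _ _ rfl]
    simp [idConeMap, mappingCone.map]
  simp [this]

/-- A morphism `Q.X i ⟶ Y` is a cochain of degree zero from `Q` to `Y` placed in degree `i`, which
can be lifted by `LiftsAlongAcyclic.exists_cochain_lift`. -/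
lemma LiftsAlongAcyclic.projective_X {Q : CochainComplex B ℤ} (h : LiftsAlongAcyclic Q) (i : ℤ) :
    Projective (Q.X i) where
  factors {X Y} f e _ := by
    have : Epi ((singleFunctor B i).map e) :=
      inferInstanceAs (Epi ((HomologicalComplex.single B (.up ℤ) i).map e))
    obtain ⟨γ, hγ⟩ := h.exists_cochain_lift ((singleFunctor B i).map e)
      (Cochain.toSingleMk f (add_zero i))
    obtain ⟨g, rfl⟩ := Cochain.toSingleMk_surjective γ i (add_zero i)
    refine ⟨g, ?_⟩
    rw [← Cochain.toSingleMk_postcomp] at hγ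
    exact (Cochain.toSingleEquiv (add_zero i)).symm.injective hγ

lemma LiftsAlongAcyclic.hprProj {Q : CochainComplex B ℤ} (h : LiftsAlongAcyclic Q) :
    hprProj B Q :=
  ⟨h.projective_X, h.isKProjective⟩

instance projective_shift_X (L : CochainComplex B ℤ) [∀ i, Projective (L.X i)] (n i : ℤ) :
    Projective ((L⟦n⟧).X i) :=
  inferInstanceAs (Projective (L.X (i + n)))

lemma extVanishes_one_of_homotopy {L M R : CochainComplex B ℤ} (e : L⟦(1 : ℤ)⟧ ≅ M)
    [∀ i, Projective (L.X i)] (h : ∀ f : L ⟶ R, Nonempty (Homotopy f 0)) :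
    ExtVanishes M R 1 := by
  have : Projective (idConeShortComplex e).X₂ := projective_idCone L
  exact extVanishes_one_of_exists_extension (idConeShortComplex_shortExact e)
    fun f => (exists_idCone_extension_iff f).2 (h f)

lemma homotopy_of_extVanishes_one {L M R : CochainComplex B ℤ} (e : L⟦(1 : ℤ)⟧ ≅ M)
    (h : ExtVanishes M R 1) (f : L ⟶ R) : Nonempty (Homotopy f 0) :=
  (exists_idCone_extension_iff f).1
    (ExtVanishes.exists_extension (idConeShortComplex_shortExact e) h f)

lemma leftPerp_of_hprProj {Q : CochainComplex B ℤ} (h : hprProj B Q) :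
    leftPerp (acyclic B) Q := by
  intro R hR
  have := h.1
  have := h.2
  exact extVanishes_one_of_homotopy (shiftNegOneIso Q)
    fun f => IsKProjective.nonempty_homotopy_zero f hR

lemma hprProj_iff_liftsAlongAcyclic (Q : CochainComplex B ℤ) :
    hprProj B Q ↔ LiftsAlongAcyclic Q :=
  ⟨fun h => liftsAlongAcyclic_of_leftPerp (leftPerp_of_hprProj h), fun h => h.hprProj⟩

lemma hprProj_eq_leftPerp : hprProj B = leftPerp (acyclic B) := by
  ext Q
  exact ⟨leftPerp_of_hprProj, fun h => (liftsAlongAcyclic_of_leftPerp h).hprProj⟩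

lemma hprProj_of_iso {Q Q' : CochainComplex B ℤ} (e : Q ≅ Q') (h : hprProj B Q) :
    hprProj B Q' := by
  rw [hprProj_iff_liftsAlongAcyclic] at h ⊢
  exact h.of_iso e

lemma hprProj_shift {Q : CochainComplex B ℤ} (h : hprProj B Q) (n : ℤ) : hprProj B (Q⟦n⟧) := by
  have := h.1
  have := h.2
  exact ⟨inferInstance, inferInstance⟩

/-- Dimension shifting along `Q⟦-1⟧ ⟶ idCone (Q⟦-1⟧) ⟶ Q` reduces to `Ext^1`. -/
lemma extVanishes_of_hprProj {Q R : CochainComplex B ℤ} (hQ : hprProj B Q) (hR : R.Acyclic)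
    (n : ℕ) : ExtVanishes Q R (n + 1) := by
  induction n generalizing Q with
  | zero => exact leftPerp_of_hprProj hQ R hR
  | succ n ih =>
    have := hQ.1
    have : Projective (idConeShortComplex (shiftNegOneIso Q)).X₂ := projective_idCone _
    exact extVanishes_succ (idConeShortComplex_shortExact (shiftNegOneIso Q)) _
      (ih (hprProj_shift hQ (-1)))

lemma isHereditary_hprProj_acyclic : IsHereditary (hprProj B) (acyclic B) := by
  intro Q R hQ hR n hn
  obtain ⟨n, rfl⟩ := Nat.exists_eq_add_of_le' hn
  exact extVanishes_of_hprProj hQ hR n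

lemma hprProj_X₁ {S : ShortComplex (CochainComplex B ℤ)} (hS : S.ShortExact)
    (h₂ : hprProj B S.X₂) (h₃ : hprProj B S.X₃) : hprProj B S.X₁ := by
  rw [hprProj_eq_leftPerp]
  intro R hR
  exact extVanishes_X₁ hS (extVanishes_of_hprProj h₂ hR 0) (extVanishes_of_hprProj h₃ hR 1)

/-- A complex that is both homotopy projective with projective terms and acyclic is a direct
summand of the cone of its identity. -/
lemma projective_of_hprProj_of_acyclic {Q : CochainComplex B ℤ} (h : hprProj B Q)
    (hQ : Q.Acyclic) : Projective Q := by
  have := h.1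
  have := h.2
  obtain ⟨r, hr⟩ := (exists_idCone_extension_iff (𝟙 Q)).2
    (IsKProjective.nonempty_homotopy_zero _ hQ)
  have := projective_idCone Q
  exact Retract.projective ⟨mappingCone.inr (𝟙 Q), r, hr⟩

/-- A projective complex is contractible, as it is a direct summand of `idCone (Q⟦-1⟧)`. -/
lemma acyclic_of_projective (Q : CochainComplex B ℤ) [Projective Q] : Q.Acyclic := by
  obtain ⟨h⟩ := homotopy_zero_of_idCone (Projective.factorThru (𝟙 Q) (idConeCover Q))
    (idConeCover Q)
  rw [Projective.factorThru_comp] at h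
  exact acyclic_of_homotopy_id h

end Hpr

/-! ### Projective generators -/

lemma epi_of_isSeparator {B : Type u} [Category.{v} B] {P : B} (hP : IsSeparator P) {X Y : B}
    (f : X ⟶ Y) (h : ∀ y : P ⟶ Y, ∃ x : P ⟶ X, x ≫ f = y) : Epi f where
  left_cancellation a b hab := hP.def _ _ fun y => by
    obtain ⟨x, rfl⟩ := h y
    simp [hab]

lemma projective_coproduct {B : Type u} [Category.{v} B] [HasCoproducts.{w} B] {ι : Type w}
    (G : ι → B) [∀ i, Projective (G i)] : Projective (∐ G) where
  factors f e _ := ⟨Sigma.desc fun i => Projective.factorThru (Sigma.ι G i ≫ f) e, by cat_disch⟩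

/-- Every object is a quotient of a coproduct of copies of `P` indexed by the morphisms from
`P`. -/
lemma enoughProjectives_of_isSeparator {B : Type u} [Category.{v} B] [HasCoproducts.{w} B]
    [LocallySmall.{w} B] {P : B} [Projective P] (hP : IsSeparator P) : EnoughProjectives B where
  presentation X := ⟨{
    projective := projective_coproduct.{w} _
    p := ∐ fun _ : Shrink.{w} (P ⟶ X) => P
    f := Sigma.desc fun i => (equivShrink (P ⟶ X)).symm i
    epi := ⟨fun f g h => hP.def _ _ fun x => by
      simpa using Sigma.ι (fun _ : Shrink.{w} (P ⟶ X) => P) (equivShrink _ x) ≫= h⟩ }⟩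

section Separator

variable {B : Type u} [Category.{v} B] [Abelian B]

/-- If `S` is a small set of generators, the coproduct of projective objects covering the elements
of `S` is a projective generator. -/
lemma exists_projective_isSeparator (κ : Cardinal.{w}) [Fact κ.IsRegular]
    [IsCardinalLocallyPresentable B κ] [EnoughProjectives B] :
    ∃ P : B, Projective P ∧ IsSeparator P := by
  classical
  obtain ⟨S, _, hS⟩ := HasCardinalFilteredGenerator.exists_small_generator B κ
  let G (i : Shrink.{w} (Subtype S)) : B := Projective.over ((equivShrink _).symm i).1
  refine ⟨∐ G, projective_coproduct.{w} G, (isSeparator_def _).2 fun X Y f g h => ?_⟩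
  refine hS.isStrongGenerator.isSeparating _ _ fun A hA a => ?_
  obtain ⟨i, hi⟩ := (equivShrink (Subtype S)).symm.surjective ⟨A, hA⟩
  obtain rfl : ((equivShrink _).symm i).1 = A := congrArg Subtype.val hi
  rw [← cancel_epi (Projective.π _)]
  simpa using Sigma.ι G i ≫= h (Sigma.desc fun j =>
    if hj : j = i then eqToHom (by rw [hj]) ≫ Projective.π _ ≫ a else 0)

theorem enoughProjectives_iff [IsLocallyPresentable.{w} B] :
    EnoughProjectives B ↔ ∃ P : B, Projective P ∧ IsSeparator P := by
  obtain ⟨κ, _, _⟩ := IsLocallyPresentable.exists_cardinal.{w} B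
  refine ⟨fun _ => exists_projective_isSeparator κ, ?_⟩
  rintro ⟨P, _, hP⟩
  exact enoughProjectives_of_isSeparator.{w} hP

end Separator

/-! ### The cotorsion pair generated by the shifts of a projective generator -/

section Acyclic

open CochainComplex CochainComplex.HomComplex HomologicalComplex

variable {B : Type u} [Category.{v} B] [Abelian B]

/-- Exactness can be tested on generalized elements defined on a projective generator. -/
lemma exact_of_isSeparator {P : B} [Projective P] (hP : IsSeparator P) (S : ShortComplex B)
    (h : ∀ x : P ⟶ S.X₂, x ≫ S.g = 0 → ∃ y : P ⟶ S.X₁, y ≫ S.f = x) : S.Exact := by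
  have : (preadditiveCoyoneda.obj (Opposite.op P)).Faithful :=
    ⟨fun {X Y f g} hfg => hP.def _ _ fun x => ConcreteCategory.congr_hom hfg x⟩
  apply Functor.reflects_exact_of_faithful (preadditiveCoyoneda.obj (Opposite.op P))
  rw [ShortComplex.ab_exact_iff]
  exact h

/-- Morphisms from `P` in degree `n` to `K` are the cycles of degree `n` of `Hom(P, K)`, and the
null-homotopic ones are the boundaries. -/
lemma acyclic_of_homotopy_single {P : B} [Projective P] (hP : IsSeparator P)
    {K : CochainComplex B ℤ}
    (h : ∀ (n : ℤ) (f : (singleFunctor B n).obj P ⟶ K), Nonempty (Homotopy f 0)) :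
    K.Acyclic := by
  intro n
  rw [exactAt_iff' K (n - 1) n (n + 1) (by simp) (by simp)]
  refine exact_of_isSeparator hP _ fun x hx => ?_
  let z := Cocycle.fromSingleMk x (add_zero n) (n + 1) rfl hx
  obtain ⟨ho⟩ := h n (Cocycle.homOf z)
  obtain ⟨α, hα⟩ := Cochain.equivHomotopy _ _ ho
  refine (Cocycle.fromSingleMk_mem_coboundaries_iff x (add_zero n) (n + 1) rfl hx (n - 1)
    (by simp)).1 ?_
  rw [mem_coboundaries_iff _ (-1) (by simp)]
  exact ⟨α, by simpa using hα.symm⟩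

lemma projective_single_X (P : B) [Projective P] (n i : ℤ) :
    Projective (((singleFunctor B n).obj P).X i) := by
  by_cases h : i = n
  · subst h
    exact Projective.of_iso (singleObjXSelf (.up ℤ) i P).symm inferInstance
  · exact (isZero_single_obj_X (.up ℤ) n P i h).projective

lemma hprProj_single (P : B) [Projective P] (n : ℤ) :
    hprProj B ((singleFunctor B n).obj P) := by
  have := projective_single_X P n
  exact ⟨this, isKProjective_of_projective _ n⟩

/-- The isomorphism between `P[i]` and the complex `P` concentrated in degree `-i`. -/
noncomputable def shiftSingleIso (P : B) (i n a : ℤ) (h : i + a = n) :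
    ((singleFunctor B n).obj P)⟦i⟧ ≅ (singleFunctor B a).obj P :=
  ((singleFunctors B).shiftIso i a n h).app P

lemma acyclic_of_shifts {P : B} [Projective P] (hP : IsSeparator P) {K : CochainComplex B ℤ}
    (h : rightPerp (shifts P) K) : K.Acyclic := by
  refine acyclic_of_homotopy_single hP fun n f => ?_
  -- The complex `P` in degree `n` is `P[-n]`, and null-homotopies of the morphisms from it to `K`
  -- are governed by `Ext^1` of its shift `P[1 - n]`.
  have h₁ := h _ (ObjectProperty.ofObj_apply _ (1 - n))
  have e : ((singleFunctor B n).obj P)⟦(1 : ℤ)⟧ ≅ ((singleFunctor B 0).obj P)⟦1 - n⟧ :=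
    shiftSingleIso P 1 n (n - 1) (by lia) ≪≫ (shiftSingleIso P (1 - n) 0 (n - 1) (by lia)).symm
  exact homotopy_of_extVanishes_one e h₁ f

lemma shifts_le_hprProj (P : B) [Projective P] : shifts P ≤ hprProj B := by
  rintro _ ⟨i⟩
  exact hprProj_shift (hprProj_single P 0) i

lemma acyclic_le_rightPerp : acyclic B ≤ rightPerp (hprProj B) :=
  fun _ hK _ hQ => leftPerp_of_hprProj hQ _ hK

lemma isGeneratedBy_shifts {P : B} [Projective P] (hP : IsSeparator P) :
    IsGeneratedBy (shifts P) (hprProj B) (acyclic B) where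
  right_eq := le_antisymm
    (fun K hK _ hQ => acyclic_le_rightPerp K hK _ (shifts_le_hprProj P _ hQ))
    fun _ hK => acyclic_of_shifts hP hK
  left_eq := hprProj_eq_leftPerp

lemma isCotorsionPair {P : B} [Projective P] (hP : IsSeparator P) :
    IsCotorsionPair (hprProj B) (acyclic B) where
  right_eq := le_antisymm acyclic_le_rightPerp
    fun _ hK => acyclic_of_shifts hP fun _ hQ => hK _ (shifts_le_hprProj P _ hQ)
  left_eq := hprProj_eq_leftPerp

end Acyclic

/-! ### Generating cofibrations and the small object argument -/

section Generators

open CochainComplex CochainComplex.HomComplex HomologicalComplex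
open scoped ZeroObject

variable {B : Type u} [Category.{v} B] [Abelian B]

/-- Morphisms from the cone of `𝟙 L` to `X` are cochains of degree `-1` from `L` to `X`. -/
noncomputable def idConeHomEquiv (L X : CochainComplex B ℤ) :
    (idCone L ⟶ X) ≃ Cochain L X (-1) where
  toFun f := (mappingCone.inl (𝟙 L)).comp (Cochain.ofHom f) (add_zero _)
  invFun α := idConeDesc α
  left_inv _ := idCone_hom_ext (inl_idConeDesc _)
  right_inv α := inl_idConeDesc α

/-- The cone of the identity of an object `P` concentrated in degree `n` is a disc: it
corepresents the functor sending `X` to the morphisms from `P` to the term `X^m`,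
where `m = n - 1`. -/
noncomputable def idConeSingleCorepresentableBy (P : B) (n m : ℤ) (h : n + -1 = m) :
    (eval B (ComplexShape.up ℤ) m ⋙ coyoneda.obj (Opposite.op P)).CorepresentableBy
      (idCone ((singleFunctor B n).obj P)) where
  homEquiv {X} := (idConeHomEquiv _ X).trans (Cochain.fromSingleEquiv h).toEquiv
  homEquiv_comp g f := by
    change (singleObjXSelf (.up ℤ) n P).inv ≫ ((mappingCone.inl _).comp
      (Cochain.ofHom (f ≫ g)) (add_zero _)).v n m h = ((singleObjXSelf (.up ℤ) n P).inv ≫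
        ((mappingCone.inl _).comp (Cochain.ofHom f) (add_zero _)).v n m h) ≫ g.f m
    simp only [Cochain.comp_zero_cochain_v, Cochain.ofHom_v, comp_f]
    exact ((Category.assoc _ _ _).trans (congrArg _ (Category.assoc _ _ _))).symm

lemma isCardinalPresentable_idCone_single [HasColimitsOfSize.{w, w} B] (κ : Cardinal.{w})
    [Fact κ.IsRegular] (P : B) [IsCardinalPresentable P κ] (n : ℤ) :
    IsCardinalPresentable (idCone ((singleFunctor B n).obj P)) κ := by
  have : (coyoneda.obj (Opposite.op P)).IsCardinalAccessible κ := ‹IsCardinalPresentable P κ›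
  have : PreservesColimitsOfSize.{w, w} (eval B (ComplexShape.up ℤ) (n + -1)) :=
    ⟨inferInstance⟩
  exact Functor.isCardinalAccessible_of_natIso
    (idConeSingleCorepresentableBy P n (n + -1) rfl).toIso.symm κ

/-- A complex concentrated in one degree is a cokernel of a morphism between two discs. -/
lemma isCardinalPresentable_single [HasColimitsOfSize.{w, w} B] (κ : Cardinal.{w})
    [Fact κ.IsRegular] (P : B) [IsCardinalPresentable P κ] (n : ℤ) :
    IsCardinalPresentable ((singleFunctor B n).obj P) κ := by
  let e₁ := shiftSingleIso P 1 (n + 1) n (by lia)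
  let e₂ := shiftSingleIso P 1 (n + 2) (n + 1) (by lia)
  have h₁ := idConeShortComplex_shortExact e₁
  have := (idConeShortComplex_shortExact e₂).epi_g
  have hc := isCokernelEpiComp h₁.gIsCokernel (idConeShortComplex e₂).g rfl
  have (k : WalkingParallelPair) : IsCardinalPresentable ((parallelPair
      ((idConeShortComplex e₂).g ≫ (idConeShortComplex e₁).f) 0).obj k) κ := by
    cases k
    · exact isCardinalPresentable_idCone_single κ P (n + 2)
    · exact isCardinalPresentable_idCone_single κ P (n + 1)
  have hA : HasCardinalLT (Arrow WalkingParallelPair) Cardinal.aleph0.{w} := by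
    simp only [hasCardinalLT_aleph0_iff]
    infer_instance
  exact isCardinalPresentable_of_isColimit' _ hc κ
    (hA.of_le (Cardinal.IsRegular.aleph0_le Fact.out))

/-- The generating cofibrations: the inclusions of the complexes `P[i]` in their cones. -/
def genCof (P : B) : MorphismProperty (CochainComplex B ℤ) :=
  MorphismProperty.ofHoms fun n : ℤ => mappingCone.inr (𝟙 ((singleFunctor B n).obj P))

/-- The generating trivial cofibrations: the morphisms from zero to the cones of the
complexes `P[i]`. -/
def genTrivCof (P : B) : MorphismProperty (CochainComplex B ℤ) :=
  MorphismProperty.ofHoms fun n : ℤ =>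
    (0 : (0 : CochainComplex B ℤ) ⟶ idCone ((singleFunctor B n).obj P))

instance (P : B) : MorphismProperty.IsSmall.{w} (genCof P) :=
  have : Small.{w} ℤ := Countable.toSmall _
  MorphismProperty.isSmall_ofHoms _

instance (P : B) : MorphismProperty.IsSmall.{w} (genTrivCof P) :=
  have : Small.{w} ℤ := Countable.toSmall _
  MorphismProperty.isSmall_ofHoms _

instance [LocallySmall.{w} B] : LocallySmall.{w} (CochainComplex B ℤ) where
  hom_small X Y := by
    have : Function.Injective (fun (f : X ⟶ Y) (i : ℤ) => f.f i) := fun f g h => by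
      ext i
      exact congrFun h i
    exact small_of_injective this

lemma hasSmallObjectArgument_genCof [HasColimitsOfSize.{w, w} B] [LocallySmall.{w} B] (P : B)
    [IsPresentable.{w} P] : MorphismProperty.HasSmallObjectArgument.{w} (genCof P) := by
  obtain ⟨κ, _, _⟩ := Functor.IsAccessible.exists_cardinal.{w} (F := coyoneda.obj (Opposite.op P))
  have : IsCardinalPresentable P κ := ‹_›
  have : HasColimitsOfSize.{w, w} (CochainComplex B ℤ) := ⟨inferInstance⟩
  have : Nonempty κ.ord.ToType := by
    simpa using (Fact.out : κ.IsRegular).ne_zero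
  have := WellFoundedLT.toOrderBot κ.ord.ToType
  exact ⟨κ, inferInstance, inferInstance,
    { preservesColimit {_ _ X Y} i hi f hf := by
        obtain ⟨n⟩ := hi
        have := isCardinalPresentable_single κ P n
        have := preservesColimitsOfShape_of_isCardinalPresentable_of_essentiallySmall
          ((singleFunctor B n).obj P) κ κ.ord.ToType
        infer_instance }⟩

/-- The epimorphisms with acyclic kernel. -/
abbrev trivFib (B : Type u) [Category.{v} B] [Abelian B] :
    MorphismProperty (CochainComplex B ℤ) := epiWithKernel (acyclic B)

/-- Lifting a morphism from a disc along `p` amounts to lifting a morphism from `P` along a term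
of `p`. -/
lemma epi_of_rlp_genTrivCof {P : B} (hP : IsSeparator P) {X Y : CochainComplex B ℤ} (p : X ⟶ Y)
    (hp : (genTrivCof P).rlp p) : Epi p := by
  have (i : ℤ) : Epi (p.f i) := epi_of_isSeparator hP _ fun y => by
    let R := idConeSingleCorepresentableBy P (i + 1) i (by lia)
    have := hp _ ⟨i + 1⟩
    have sq : CommSq 0 (0 : 0 ⟶ idCone ((singleFunctor B (i + 1)).obj P)) p
      (R.homEquiv.symm y) := ⟨by simp⟩
    refine ⟨R.homEquiv sq.lift, ?_⟩
    have h := R.homEquiv_comp p sq.lift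
    rw [sq.fac_right] at h
    exact h.symm.trans (R.homEquiv.apply_symm_apply y)
  exact HomologicalComplex.epi_of_epi_f p this

lemma rlp_genTrivCof {P : B} [Projective P] (hP : IsSeparator P) :
    (genTrivCof P).rlp = MorphismProperty.epimorphisms (CochainComplex B ℤ) := by
  refine le_antisymm (fun _ _ p hp => epi_of_rlp_genTrivCof hP p hp) ?_
  rintro X Y p (hp : Epi p) _ _ _ ⟨n⟩
  have := projective_single_X P n
  have := projective_idCone ((singleFunctor B n).obj P)
  exact ⟨fun {a b} sq => ⟨⟨{
    l := Projective.factorThru b p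
    fac_left := (isZero_zero _).eq_of_src _ _
    fac_right := by simp }⟩⟩⟩

/-- A morphism with the right lifting property with respect to the generating cofibrations
also has it with respect to the generating trivial cofibrations: the morphism `0 ⟶ L` is a
pushout of a generating cofibration if `L` is a complex `P[i]`. -/
lemma rlp_genCof_le (P : B) : (genCof P).rlp ≤ (genTrivCof P).rlp := by
  intro X Y p hp _ _ _ ⟨n⟩
  refine ⟨fun {a b} sq => ?_⟩
  let e := shiftSingleIso P 1 (n + 1) n (by lia)
  have hS := idConeShortComplex_shortExact e
  have h₁ := hp _ ⟨n + 1⟩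
  have h₂ := hp _ ⟨n⟩
  have := hS.epi_g
  have sq₁ : CommSq 0 (mappingCone.inr (𝟙 ((singleFunctor B (n + 1)).obj P))) p
      ((idConeShortComplex e).g ≫ mappingCone.inr (𝟙 ((singleFunctor B n).obj P)) ≫ b) :=
    ⟨by rw [zero_comp]; exact ((idConeShortComplex e).zero_assoc _).trans zero_comp |>.symm⟩
  let l : (singleFunctor B n).obj P ⟶ X := hS.exact.desc sq₁.lift sq₁.fac_left
  have hl : (idConeShortComplex e).g ≫ l = sq₁.lift := hS.exact.g_desc _ _
  have sq₂ : CommSq l (mappingCone.inr (𝟙 ((singleFunctor B n).obj P))) p b := ⟨by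
    rw [← cancel_epi (idConeShortComplex e).g, reassoc_of% hl, sq₁.fac_right]⟩
  exact ⟨⟨{
    l := sq₂.lift
    fac_left := (isZero_zero _).eq_of_src _ _
    fac_right := sq₂.fac_right }⟩⟩

lemma hasLiftingProperty_of_hprProj {A A' X Y : CochainComplex B ℤ} (i : A ⟶ A') (p : X ⟶ Y)
    (hi : monoWithCokernel (hprProj B) i) (hp : trivFib B p) : HasLiftingProperty i p := by
  have := hi.1
  have := hp.1
  exact hasLiftingProperty_of_extVanishes i p (leftPerp_of_hprProj hi.2 _ hp.2)

lemma genCof_le (P : B) [Projective P] : genCof P ≤ monoWithCokernel (hprProj B) := by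
  rintro _ _ _ ⟨n⟩
  have hS := idConeShortComplex_shortExact (Iso.refl (((singleFunctor B n).obj P)⟦(1 : ℤ)⟧))
  have := hS.mono_f
  exact ⟨this, hprProj_of_iso (hS.gIsCokernel.coconePointUniqueUpToIso (colimit.isColimit _))
    (hprProj_shift (hprProj_single P n) 1)⟩

/-- Lifting against the inclusion of `P[i]` in its cone shows that all morphisms from `P[i]` to the
kernel of `p` are null-homotopic, so that this kernel is acyclic. -/
lemma rlp_genCof {P : B} [Projective P] (hP : IsSeparator P) : (genCof P).rlp = trivFib B := by
  refine le_antisymm (fun X Y p hp => ?_) fun _ _ _ hp _ _ _ hi =>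
    hasLiftingProperty_of_hprProj _ _ (genCof_le P _ hi) hp
  have : Epi p := epi_of_rlp_genTrivCof hP p (rlp_genCof_le P _ hp)
  refine ⟨this, acyclic_of_homotopy_single hP fun n f => ?_⟩
  rw [← exists_idCone_extension_iff]
  have := hp _ ⟨n⟩
  have sq : CommSq (f ≫ kernel.ι p) (mappingCone.inr (𝟙 ((singleFunctor B n).obj P))) p 0 :=
    ⟨by simp⟩
  refine ⟨kernel.lift p sq.lift sq.fac_right, ?_⟩
  rw [← cancel_mono (kernel.ι p)]
  simp

lemma llp_trivFib : (trivFib B).llp = monoWithCokernel (hprProj B) := by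
  refine le_antisymm (fun A A' i hi => ⟨?_, LiftsAlongAcyclic.hprProj ?_⟩)
    fun _ _ _ hi _ _ _ hp => hasLiftingProperty_of_hprProj _ _ hi hp
  -- `i` is a monomorphism because the monomorphism from `A` to the acyclic complex `idCone A`
  -- factors through it.
  · have : trivFib B (0 : idCone A ⟶ 0) := ⟨inferInstance,
      fun n => (acyclic_idCone A n).of_iso (kernelZeroIsoSource (X := idCone A) (Y := 0)).symm⟩
    have := hi _ this
    have sq : CommSq (mappingCone.inr (𝟙 A)) i (0 : idCone A ⟶ 0) 0 := ⟨by simp⟩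
    have : Mono (mappingCone.inr (𝟙 A)) :=
      (idConeShortComplex_shortExact (Iso.refl (A⟦(1 : ℤ)⟧))).mono_f
    exact mono_of_mono_fac sq.fac_left
  -- A lift of the composition of `f` and the projection to the cokernel that vanishes on `A`
  -- descends to the cokernel.
  · intro X Y p hp hK f
    have := hi p ⟨hp, hK⟩
    have sq : CommSq 0 i p (cokernel.π i ≫ f) := ⟨by simp⟩
    refine ⟨cokernel.desc i sq.lift sq.fac_left, ?_⟩
    rw [← cancel_epi (cokernel.π i)]
    simp

end Generators

/-! ### Quasi-isomorphisms -/

section QuasiIso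

open HomologicalComplex

variable {B : Type u} [Category.{v} B] [Abelian B]

lemma quasiIso_f_iff {S : ShortComplex (CochainComplex B ℤ)} (hS : S.ShortExact) :
    QuasiIso S.f ↔ S.X₃.Acyclic := by
  refine ⟨hS.acyclic_X₃, fun h => ⟨fun i => ?_⟩⟩
  have h₀ (i : ℤ) : IsZero (S.X₃.homology i) := (exactAt_iff_isZero_homology _ _).1 (h i)
  rw [quasiIsoAt_iff_isIso_homologyMap]
  have : Mono (homologyMap S.f i) :=
    (hS.homology_exact₁ (i - 1) i (by simp)).mono_g ((h₀ _).eq_of_src _ _)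
  have : Epi (homologyMap S.f i) := (hS.homology_exact₂ i).epi_f ((h₀ _).eq_of_tgt _ _)
  exact isIso_of_mono_of_epi _

lemma quasiIso_g_iff {S : ShortComplex (CochainComplex B ℤ)} (hS : S.ShortExact) :
    QuasiIso S.g ↔ S.X₁.Acyclic := by
  refine ⟨hS.acyclic_X₁, fun h => ⟨fun i => ?_⟩⟩
  have h₀ (i : ℤ) : IsZero (S.X₁.homology i) := (exactAt_iff_isZero_homology _ _).1 (h i)
  rw [quasiIsoAt_iff_isIso_homologyMap]
  have : Epi (homologyMap S.g i) :=
    (hS.homology_exact₃ i (i + 1) (by simp)).epi_f ((h₀ _).eq_of_tgt _ _)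
  have : Mono (homologyMap S.g i) := (hS.homology_exact₂ i).mono_g ((h₀ _).eq_of_src _ _)
  exact isIso_of_mono_of_epi _

lemma acyclic_of_iso {X Y : CochainComplex B ℤ} (e : X ≅ Y) (h : X.Acyclic) : Y.Acyclic :=
  fun i => (h i).of_iso e

end QuasiIso

/-! ### The model structure -/

section Model

open HomologicalComplex
open scoped ZeroObject

variable {B : Type u} [Category.{v} B] [Abelian B]

lemma monoWithCokernel_iff_of_isZero {X Y : CochainComplex B ℤ} (hX : IsZero X) (f : X ⟶ Y) :
    monoWithCokernel (hprProj B) f ↔ hprProj B Y := by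
  obtain rfl : f = 0 := hX.eq_of_src _ _
  have : Mono (0 : X ⟶ Y) := ⟨fun a b _ => hX.eq_of_tgt _ _⟩
  exact ⟨fun h => hprProj_of_iso cokernelZeroIsoTarget h.2,
    fun h => ⟨this, hprProj_of_iso cokernelZeroIsoTarget.symm h⟩⟩

lemma trivFib_eq : trivFib B =
    MorphismProperty.epimorphisms _ ⊓ quasiIso B (ComplexShape.up ℤ) := by
  ext X Y p
  constructor
  · rintro ⟨h₁, h₂⟩
    exact ⟨h₁, (quasiIso_g_iff (shortExact_of_epi p)).2 h₂⟩
  · rintro ⟨h₁, h₂⟩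
    have : Epi p := h₁
    exact ⟨h₁, (quasiIso_g_iff (shortExact_of_epi p)).1 h₂⟩

lemma hasFactorization_cof_trivFib [HasColimitsOfSize.{w, w} B] [LocallySmall.{w} B] {P : B}
    [IsPresentable.{w} P] [Projective P] (hP : IsSeparator P) :
    (monoWithCokernel (hprProj B)).HasFactorization (trivFib B) := by
  have := hasSmallObjectArgument_genCof.{w} P
  rw [← llp_trivFib, ← rlp_genCof hP]
  infer_instance

/-- The cokernel of `i` is acyclic and homotopy projective with projective terms, hence
projective. -/
lemma hasLiftingProperty_trivCof_fib {A A' X Y : CochainComplex B ℤ} (i : A ⟶ A') (p : X ⟶ Y)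
    (hi : (monoWithCokernel (hprProj B) ⊓ quasiIso B (ComplexShape.up ℤ)) i)
    [Epi p] : HasLiftingProperty i p := by
  have := hi.1.1
  have := projective_of_hprProj_of_acyclic hi.1.2
    ((quasiIso_f_iff (shortExact_of_mono i)).1 hi.2)
  exact hasLiftingProperty_of_extVanishes i p (extVanishes_of_projective _ _ 0)

instance : (monoWithCokernel (hprProj B)).IsStableUnderRetracts := by
  rw [← llp_trivFib]
  infer_instance

variable [(monoWithCokernel (hprProj B)).HasFactorization (trivFib B)]

variable (B) in
lemma isComplete_of_hasFactorization : IsComplete (hprProj B) (acyclic B) where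
  precover E := by
    have F := MorphismProperty.factorizationData (monoWithCokernel (hprProj B)) (trivFib B)
      (0 : 0 ⟶ E)
    have := F.hp.1
    exact ⟨kernel F.p, F.Z, kernel.ι F.p, F.p, kernel.condition _, F.hp.2,
      (monoWithCokernel_iff_of_isZero (Limits.isZero_zero _) F.i).1 F.hi, shortExact_of_epi F.p⟩
  preenvelope E := by
    have F := MorphismProperty.factorizationData (monoWithCokernel (hprProj B)) (trivFib B)
      (0 : E ⟶ 0)
    have := F.hi.1
    have hz : (0 : CochainComplex B ℤ).Acyclic := acyclic_of_isZero _ (Limits.isZero_zero _)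
    have hp := F.hp.1
    refine ⟨F.Z, cokernel F.i, F.i, cokernel.π F.i, cokernel.condition _, ?_, F.hi.2,
      shortExact_of_mono F.i⟩
    exact (shortExact_of_epi F.p).acyclic_X₂ F.hp.2 hz

/-- `Y` is a quotient of a complex `L` with projective terms, and `L` is a quotient of the
projective complex `idCone (L⟦-1⟧)`. -/
lemma exists_projective_epi (Y : CochainComplex B ℤ) :
    ∃ (D : CochainComplex B ℤ) (q : D ⟶ Y), Projective D ∧ Epi q := by
  obtain ⟨_, L, _, p, _, _, hL, hS⟩ := (isComplete_of_hasFactorization B).precover Y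
  have := hS.epi_g
  have := hL.1
  exact ⟨_, idConeCover L ≫ p, projective_idCone _, epi_comp _ _⟩

/-- A morphism `X ⟶ Y` is factored through `X ⊞ D`, where `D` is a projective complex that has an
epimorphism to `Y`. -/
instance hasFactorization_trivCof_fib :
    (monoWithCokernel (hprProj B) ⊓ quasiIso B (ComplexShape.up ℤ)).HasFactorization
      (MorphismProperty.epimorphisms _) where
  nonempty_mapFactorizationData {X Y} f := by
    obtain ⟨D, q, _, _⟩ := exists_projective_epi Y
    have e : cokernel (biprod.inl : X ⟶ X ⊞ D) ≅ D := cokernelBiprodInlIso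
    refine ⟨{
      Z := X ⊞ D
      i := biprod.inl
      p := biprod.desc f q
      hi := ⟨⟨inferInstance, hprProj_of_iso e.symm
        (liftsAlongAcyclic_of_projective D).hprProj⟩, ?_⟩
      hp := ?_ }⟩
    · exact (quasiIso_f_iff (shortExact_of_mono _)).2
        (acyclic_of_iso e.symm (acyclic_of_projective D))
    · have : Epi (biprod.inr ≫ biprod.desc f q : D ⟶ Y) := by simpa
      exact epi_of_epi (biprod.inr) _

/-- The model structure on complexes whose weak equivalences are the quasi-isomorphisms and whose
fibrations are the epimorphisms. -/
@[reducible]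
noncomputable def projectiveModelCategory {P : B} [Projective P] (hP : IsSeparator P) :
    ModelCategory (CochainComplex B ℤ) :=
  letI : CategoryWithCofibrations (CochainComplex B ℤ) := ⟨monoWithCokernel (hprProj B)⟩
  letI : CategoryWithFibrations (CochainComplex B ℤ) := ⟨MorphismProperty.epimorphisms _⟩
  letI : CategoryWithWeakEquivalences (CochainComplex B ℤ) := ⟨quasiIso B (ComplexShape.up ℤ)⟩
  haveI : (weakEquivalences (CochainComplex B ℤ)).HasTwoOutOfThreeProperty :=
    inferInstanceAs (quasiIso B (ComplexShape.up ℤ)).HasTwoOutOfThreeProperty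
  haveI hw : (weakEquivalences (CochainComplex B ℤ)).IsStableUnderRetracts :=
    inferInstanceAs (quasiIso B (ComplexShape.up ℤ)).IsStableUnderRetracts
  haveI hc : (cofibrations (CochainComplex B ℤ)).IsStableUnderRetracts :=
    inferInstanceAs (monoWithCokernel (hprProj B)).IsStableUnderRetracts
  haveI hf : (fibrations (CochainComplex B ℤ)).IsStableUnderRetracts :=
    inferInstanceAs (MorphismProperty.epimorphisms _).IsStableUnderRetracts
  have htf : trivialFibrations (CochainComplex B ℤ) = trivFib B := trivFib_eq.symm
  haveI : MorphismProperty.IsWeakFactorizationSystem (cofibrations (CochainComplex B ℤ))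
      (trivialFibrations (CochainComplex B ℤ)) := by
    rw [htf]
    change MorphismProperty.IsWeakFactorizationSystem (monoWithCokernel (hprProj B)) _
    have : (trivFib B).IsStableUnderRetracts := by
      rw [← rlp_genCof hP]
      infer_instance
    exact .mk' _ _ fun i p hi hp => hasLiftingProperty_of_hprProj i p hi hp
  haveI : MorphismProperty.IsWeakFactorizationSystem (trivialCofibrations (CochainComplex B ℤ))
      (fibrations (CochainComplex B ℤ)) := by
    have : (trivialCofibrations (CochainComplex B ℤ)).HasFactorization
        (fibrations (CochainComplex B ℤ)) := hasFactorization_trivCof_fib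
    have : (trivialCofibrations (CochainComplex B ℤ)).IsStableUnderRetracts :=
      ⟨fun h hg => ⟨hc.of_retract h hg.1, hw.of_retract h hg.2⟩⟩
    exact .mk' _ _ fun i p hi hp => by
      have : Epi p := hp
      exact hasLiftingProperty_trivCof_fib i p hi
  ModelCategory.mk' _

theorem exists_modelCategory {P : B} [Projective P] (hP : IsSeparator P) :
    ∃ _ : ModelCategory (CochainComplex B ℤ),
      IsAbelianModelStructure (CochainComplex B ℤ) ∧
      cofibrantObj (CochainComplex B ℤ) = hprProj B ∧
      weaklyTrivialObj (CochainComplex B ℤ) = acyclic B ∧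
      fibrantObj (CochainComplex B ℤ) = ⊤ ∧
      IsHereditaryModelStructure (CochainComplex B ℤ) ∧
      IsCofibrantlyGenerated.{w} (CochainComplex B ℤ) := by
  let _ := projectiveModelCategory hP
  have hc : cofibrations (CochainComplex B ℤ) = monoWithCokernel (hprProj B) := rfl
  have hf : fibrations (CochainComplex B ℤ) = MorphismProperty.epimorphisms _ := rfl
  have hw : weakEquivalences (CochainComplex B ℤ) = quasiIso B (ComplexShape.up ℤ) := rfl
  have hzero := (initialIsInitial (C := CochainComplex B ℤ)).isZero
  have h₁ : cofibrantObj (CochainComplex B ℤ) = hprProj B := by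
    ext X
    change IsCofibrant X ↔ _
    rw [isCofibrant_iff, cofibration_iff, hc]
    exact monoWithCokernel_iff_of_isZero hzero _
  have h₂ : fibrantObj (CochainComplex B ℤ) = ⊤ := by
    ext X
    change IsFibrant X ↔ _
    rw [isFibrant_iff, fibration_iff, hf]
    have hz := (terminalIsTerminal (C := CochainComplex B ℤ)).isZero
    exact ⟨fun _ => trivial, fun _ => ⟨fun _ _ _ => hz.eq_of_src _ _⟩⟩
  refine ⟨inferInstance, ⟨?_, ?_⟩, h₁, ?_, h₂, ⟨?_, ?_⟩, ⟨?_, ?_⟩⟩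
  · rw [h₁, hc]
  · rw [h₂, hf]
    ext X Y p
    exact ⟨fun h => ⟨h, trivial⟩, fun h => h.1⟩
  · ext X
    change WeakEquivalence (initial.to X) ↔ _
    rw [weakEquivalence_iff, hw]
    have hI : (⊥_ (CochainComplex B ℤ)).Acyclic := acyclic_of_isZero _ hzero
    exact ⟨fun h i => (quasiIsoAt_iff_exactAt _ i (hI i)).1 (h.quasiIsoAt i),
      fun h => quasiIso_of_acyclic _ hI h⟩
  · rw [h₁]
    exact fun S hS h₂ h₃ => hprProj_X₁ hS h₂ h₃
  · rw [h₂]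
    exact fun _ _ _ _ => trivial
  · exact ⟨genCof P, inferInstance, trivFib_eq.symm.trans (rlp_genCof hP).symm⟩
  · exact ⟨genTrivCof P, inferInstance, (rlp_genTrivCof hP).symm⟩

end Model

end AbelianModel

theorem mainTheorem1 (B : Type u) [Category.{v} B] [Abelian B] [IsLocallyPresentable.{w} B] :
    (EnoughProjectives B ↔ ∃ P : B, Projective P ∧ IsSeparator P) ∧
    (EnoughProjectives B →
      (AbelianModel.IsCotorsionPair (AbelianModel.hprProj B) (AbelianModel.acyclic B) ∧
        AbelianModel.IsComplete (AbelianModel.hprProj B) (AbelianModel.acyclic B) ∧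
        AbelianModel.IsHereditary (AbelianModel.hprProj B) (AbelianModel.acyclic B) ∧
        ∀ P : B, Projective P → IsSeparator P →
          AbelianModel.IsGeneratedBy (AbelianModel.shifts P)
            (AbelianModel.hprProj B) (AbelianModel.acyclic B)) ∧
      ∃ _ : ModelCategory (CochainComplex B ℤ),
        AbelianModel.IsAbelianModelStructure (CochainComplex B ℤ) ∧
        AbelianModel.cofibrantObj (CochainComplex B ℤ) = AbelianModel.hprProj B ∧
        AbelianModel.weaklyTrivialObj (CochainComplex B ℤ) = AbelianModel.acyclic B ∧
        AbelianModel.fibrantObj (CochainComplex B ℤ) = ⊤ ∧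
        AbelianModel.IsHereditaryModelStructure (CochainComplex B ℤ) ∧
        AbelianModel.IsCofibrantlyGenerated.{w} (CochainComplex B ℤ)) := by
  refine ⟨AbelianModel.enoughProjectives_iff.{w}, fun h => ?_⟩
  obtain ⟨P, _, hP⟩ := AbelianModel.enoughProjectives_iff.{w}.1 h
  obtain ⟨κ, _, _⟩ := IsLocallyPresentable.exists_cardinal.{w} B
  have := AbelianModel.hasFactorization_cof_trivFib.{w} hP
  exact ⟨⟨AbelianModel.isCotorsionPair hP, AbelianModel.isComplete_of_hasFactorization B,
    AbelianModel.isHereditary_hprProj_acyclic, fun Q _ hQ => AbelianModel.isGeneratedBy_shifts hQ⟩,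
    AbelianModel.exists_modelCategory.{w} hP⟩
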